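/- **Setting.** There are $n\ge 1$ agents and $m\ge 2$ alternatives. Every agent $i$ has a value $\mathrm{val}_i(a)\ge 0$ for every alternative $a$; all $nm$ values are drawn independently from a known distribution $F$. Given the valuations $v=(\mathrm{val}_i)_i$, a profile $P=(\succ_i)_i$ of rankings is drawn uniformly at random among all profiles consistent with $v$ (that is, $a\succ_i a'$ only if $\mathrm{val}_i(a)\ge \mathrm{val}_i(a')$). Let $\mathrm{sw}(a,v)=\sum_i \mathrm{val}_i(a)$. The average distortion of a (randomized) mechanism $\mathcal M$, which may use $F$, on a family $\mathcal F$ of distributions is $$\sup_{F\in\mathcal F}\frac{\mathbb E_{v}\left[\max_a \mathrm{sw}(a,v)\right]}{\mathbb E_{v,P,\mathcal M}\left[\mathrm{sw}(\mathcal M(P,v),v)\right]}.$$ **Mechanisms.** For $p\in[0,1]$ and $0/1$ valuations, the mechanism *Mean* queries every agent for her value of the alternative at position $\tau=\max\{1,\lfloor pm\rfloor\}$ of her ranking, and returns an alternative $a$ that maximizes the number of agents whose answer is $1$ and who rank $a$ at position at most $\tau$, breaking ties arbitrarily. The mechanism *RtMean* with thresholds $0<\ell_1<\dots<\ell_r$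 ($r\ge 1$) picks $t\in\{1,\dots,r\}$ uniformly at random, sets $p=\Pr_{z\sim F}[z\ge \ell_t]$, and runs Mean for this $p$, interpreting the answer $\mathrm{val}_i(a)$ to a query as $1$ if $\mathrm{val}_i(a)\ge\ell_t$ and as $0$ otherwise. **Statement.** There is an absolute constant $C>0$ such that for every $m\ge 2$ there is a choice of thresholds, depending only on $F$ and $m$, for which, for every $n\ge 1$ and every tie-breaking in Mean, RtMean has average distortion at most $C\log m$ on each of the following families: - the exponential distributions $E(\lambda)$, $\lambda>0$, for which $\mu=\frac1\lambda$ and $\sigma^2=\frac1{\lambda^2}$; - the chi-squared distributions $\chi^2(k)$, $k\ge 1$ an integer, for which $\mu=k$ and $\sigma^2=2k$; - the Erlang-$k$ distributions $E_k(\lambda)$ (density proportional to $x^{k-1}e^{-k\lambda x}$ on $x>0$), $k\ge 1$ an integer and $\lambda>0$, for which $\mu=\frac1\lambda$ and $\sigma^2=\frac1{k\lambda^2}$. Here $\mu$ and $\sigma^2$ denote the mean and the variance. -/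

import Mathlib

open MeasureTheory ProbabilityTheory
open scoped ENNReal

noncomputable section

namespace Voting

/-- A ranking (strict ordering) of the `m` alternatives, given by the bijection that sends each
alternative to its position, counted from `0`. -/
abbrev Ranking (m : ℕ) : Type := Equiv.Perm (Fin m)

/-- The position of alternative `a` in the ranking `r`, counted from `1` (the top). -/
def pos {m : ℕ} (r : Ranking m) (a : Fin m) : ℕ := (r a : ℕ) + 1

/-- A profile: one ranking of the `m` alternatives for each of the `n` agents. -/
abbrev Profile (n m : ℕ) : Type := Fin n → Ranking m

/-- Valuations: `v i a` is the value of agent `i` for alternative `a`. -/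
abbrev Valuation (n m : ℕ) : Type := Fin n → Fin m → ℝ

/-- The social welfare of alternative `a`. -/
def sw {n m : ℕ} (a : Fin m) (v : Valuation n m) : ℝ := ∑ i, v i a

/-- The profile `P` is consistent with `v`: whenever an agent ranks `a` above `a'`, her value
for `a` is at least her value for `a'`. -/
def Consistent {n m : ℕ} (P : Profile n m) (v : Valuation n m) : Prop :=
  ∀ i a a', pos (P i) a < pos (P i) a' → v i a' ≤ v i a

open scoped Classical in
/-- The finite set of all profiles that are consistent with `v`. -/
def consistentProfiles {n m : ℕ} (v : Valuation n m) : Finset (Profile n m) :=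
  Finset.univ.filter fun P => Consistent P v

theorem consistentProfiles_nonempty {n m : ℕ} (v : Valuation n m) :
    (consistentProfiles v).Nonempty := by
  classical
  refine ⟨fun i => (Tuple.sort fun a => -v i a).symm, ?_⟩
  simp only [consistentProfiles, Finset.mem_filter, Finset.mem_univ, true_and]
  intro i a a' h
  have h1 : (Tuple.sort fun a => -v i a).symm a ≤ (Tuple.sort fun a => -v i a).symm a' := by
    rw [Fin.le_def]
    simp only [pos] at h
    omega
  have h2 := Tuple.monotone_sort (fun a => -v i a) h1
  simp only [Function.comp_apply, Equiv.apply_symm_apply] at h2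
  linarith

/-- A profile chosen uniformly at random among all profiles consistent with `v`. -/
def randomProfile {n m : ℕ} (v : Valuation n m) : PMF (Profile n m) :=
  PMF.uniformOfFinset (consistentProfiles v) (consistentProfiles_nonempty v)

/-- The law of random valuations: all values `v i a` are independent with law `F`. -/
def valuationLaw (n m : ℕ) (F : Measure ℝ) : Measure (Valuation n m) :=
  Measure.pi fun _ => Measure.pi fun _ => F

/-- A deterministic mechanism. -/
abbrev Mechanism (n m : ℕ) : Type := Profile n m → Valuation n m → Fin m

/-- A randomized mechanism: it returns a random alternative. -/
abbrev RandMechanism (n m : ℕ) : Type := Profile n m → Valuation n m → PMF (Fin m)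

/-- The expected maximum social welfare when all values are drawn from `F`. -/
def expectedMaxWelfare (n m : ℕ) (F : Measure ℝ) : ℝ≥0∞ :=
  ∫⁻ v, ⨆ a : Fin m, ENNReal.ofReal (sw a v) ∂(valuationLaw n m F)

/-- The expected social welfare of the alternative returned by `M`, over the random valuations,
the random consistent profile, and the random choices of `M`. -/
def expectedWelfare {n m : ℕ} (M : RandMechanism n m) (F : Measure ℝ) : ℝ≥0∞ :=
  ∫⁻ v, ∑ P, randomProfile v P * ∑ a, M P v a * ENNReal.ofReal (sw a v) ∂(valuationLaw n m F)

/-- The average distortion of a mechanism on a family of distributions. The distribution is known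
to the mechanism, hence the argument of type `Measure ℝ`. -/
def avgDistortion {n m : ℕ} (M : Measure ℝ → RandMechanism n m) (𝓕 : Set (Measure ℝ)) : ℝ≥0∞ :=
  ⨆ F ∈ 𝓕, expectedMaxWelfare n m F / expectedWelfare (M F) F

open scoped Classical in
/-- The implied social welfare of `a` for queries at position `k`: the number of agents whose
value for the alternative at position `k` is `1` and who rank `a` at position at most `k`. -/
def impliedSW {n m : ℕ} (a : Fin m) (P : Profile n m) (v : Valuation n m) (k : ℕ) : ℕ :=
  ∑ i, if (∃ b, pos (P i) b = k ∧ v i b = 1) ∧ pos (P i) a ≤ k then 1 else 0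

/-- The position `max {1, ⌊p m⌋}` that mechanism Mean queries for the binary distribution with
success probability `p`. -/
def queryPos (p : ℝ) (m : ℕ) : ℕ := max 1 ⌊p * m⌋₊

/-- `M p` is mechanism Mean for the binary distribution with success probability `p`, under some
tie-breaking: it returns a maximizer of the implied social welfare. Ties may be broken in any
way, in particular as a function of the profile and the answers to the queries. -/
def IsMean {n m : ℕ} (M : ℝ → Mechanism n m) : Prop :=
  ∀ p ∈ Set.Icc (0 : ℝ) 1, ∀ P v a,
    impliedSW a P v (queryPos p m) ≤ impliedSW (M p P v) P v (queryPos p m)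

/-- The parameters of mechanism RtMean: thresholds `0 < ℓ 0 < ℓ 1 < ... < ℓ (k - 1)`, `1 ≤ k`. -/
structure Thresholds where
  k : ℕ
  k_pos : 0 < k
  ℓ : Fin k → ℝ
  ℓ_pos : ∀ t, 0 < ℓ t
  ℓ_strictMono : StrictMono ℓ

open scoped Classical in
/-- The binary valuations with value `1` where `v` is at least the threshold `l`. -/
def binarize {n m : ℕ} (l : ℝ) (v : Valuation n m) : Valuation n m :=
  fun i a => if l ≤ v i a then 1 else 0

/-- Mechanism RtMean with thresholds `T` for the distribution `F`, built on the implementation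
`M` of mechanism Mean: choose a threshold uniformly at random and run Mean, for the probability
`p` that a value drawn from `F` is at least the threshold, on the binarized valuations. -/
def rtMean {n m : ℕ} (M : ℝ → Mechanism n m) (T : Thresholds) (F : Measure ℝ) :
    RandMechanism n m := fun P v =>
  haveI : Nonempty (Fin T.k) := ⟨⟨0, T.k_pos⟩⟩
  (PMF.uniformOfFintype (Fin T.k)).map fun t =>
    M (F.real (Set.Ici (T.ℓ t))) P (binarize (T.ℓ t) v)

/-- The chi-squared distribution with `k` degrees of freedom: density proportional to
`x ^ (k / 2 - 1) * exp (-x / 2)` on the positive reals. -/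
def chiSquared (k : ℕ) : Measure ℝ := gammaMeasure ((k : ℝ) / 2) (1 / 2)

/-- The Erlang-`k` distribution `E_k(lam)` with mean `1 / lam`: density proportional to
`x ^ (k - 1) * exp (-k * lam * x)` on the positive reals. -/
def erlang (k : ℕ) (lam : ℝ) : Measure ℝ := gammaMeasure k (k * lam)

/-- The family of all exponential distributions. -/
def exponentialFamily : Set (Measure ℝ) := {F | ∃ lam : ℝ, 0 < lam ∧ F = expMeasure lam}

/-- The family of all chi-squared distributions. -/
def chiSquaredFamily : Set (Measure ℝ) := {F | ∃ k : ℕ, 0 < k ∧ F = chiSquared k}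

/-- The family of all Erlang distributions. -/
def erlangFamily : Set (Measure ℝ) :=
  {F | ∃ (k : ℕ) (lam : ℝ), 0 < k ∧ 0 < lam ∧ F = erlang k lam}

end Voting

end

/-! All three families consist of gamma distributions of shape `a ≥ 1/2`, so one estimate settles
them: use a single threshold, the median `l` of `F`. Then `p = 1/2`, and RtMean is just Mean
querying position `⌊m/2⌋`.

Lower bound: by the symmetry of a fair coin, an agent has at least `⌊m/2⌋` values above the median
with probability at least `1/2`. Such an agent supports `⌊m/2⌋ ≥ m/3` alternatives, each worth at
least `l` to her. The winner is at least as well supported as the average alternative, so its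
expected welfare is at least `n * l / 6` (`le_expectedWelfare_rtMean_median`). A Chernoff bound on
the lower tail gives `l ≥ (a / r) / 30` (`exists_median_gammaMeasure`).

Upper bound: the maximum welfare is at most the sum of the agents' maximal values. Each of these has
expectation at most `(2 / r) * (log m + a * log 2 + 1)`, by the moment generating function at `r /
2` (`expectedMaxWelfare_gammaMeasure_le`). As `a` is bounded below, this is `O(log m)` times the
mean `a / r`, hence times `l`. -/

section Gamma

/-! ### Moments and exponential moments of gamma distributions. -/

/-- Multiplying the gamma density by `x` gives a multiple of the gamma density whose shape is
larger by one. -/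
theorem ofReal_mul_gammaPDF {a r : ℝ} (ha : 0 < a) (hr : 0 < r) (x : ℝ) :
    ENNReal.ofReal x * gammaPDF a r x = ENNReal.ofReal (a / r) * gammaPDF (a + 1) r x := by
  rcases lt_trichotomy x 0 with hx | rfl | hx
  · simp [gammaPDF_of_neg hx]
  · simp [gammaPDF_of_nonneg le_rfl, Real.zero_rpow ha.ne']
  · rw [gammaPDF_of_nonneg hx.le, gammaPDF_of_nonneg hx.le, ← ENNReal.ofReal_mul hx.le,
      ← ENNReal.ofReal_mul (by positivity), Real.Gamma_add_one ha.ne', Real.rpow_add_one hr.ne',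
      add_sub_cancel_right, Real.rpow_sub_one hx.ne']
    have := (Real.Gamma_pos_of_pos ha).ne'
    congr 1
    field_simp

/-- Exponential tilting of the gamma density. -/
theorem ofReal_exp_mul_gammaPDF {a r s : ℝ} (hr : 0 < r) (hs : s < r) (x : ℝ) :
    ENNReal.ofReal (Real.exp (s * x)) * gammaPDF a r x =
      ENNReal.ofReal ((r / (r - s)) ^ a) * gammaPDF a (r - s) x := by
  have hrs : 0 < r - s := sub_pos.2 hs
  rcases lt_or_ge x 0 with hx | hx
  · simp [gammaPDF_of_neg hx]
  · rw [gammaPDF_of_nonneg hx, gammaPDF_of_nonneg hx, ← ENNReal.ofReal_mul (by positivity),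
      ← ENNReal.ofReal_mul (by positivity), Real.div_rpow hr.le hrs.le]
    have h1 : Real.exp (-((r - s) * x)) = Real.exp (s * x) * Real.exp (-(r * x)) := by
      rw [← Real.exp_add]; ring_nf
    have h2 := (Real.rpow_pos_of_pos hrs a).ne'
    rw [h1]
    congr 1
    field_simp

theorem measurable_gammaPDF (a r : ℝ) : Measurable (gammaPDF a r) :=
  (measurable_gammaPDFReal a r).ennreal_ofReal

/-- Taking `g` constant gives the first moment; taking `g` the identity then gives the second. -/
theorem lintegral_ofReal_mul_gammaMeasure {a r : ℝ} (ha : 0 < a) (hr : 0 < r) {g : ℝ → ℝ≥0∞}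
    (hg : Measurable g) :
    ∫⁻ x, ENNReal.ofReal x * g x ∂gammaMeasure a r =
      ENNReal.ofReal (a / r) * ∫⁻ x, g x ∂gammaMeasure (a + 1) r := by
  rw [gammaMeasure, gammaMeasure,
    lintegral_withDensity_eq_lintegral_mul _ (measurable_gammaPDF a r) (by fun_prop),
    lintegral_withDensity_eq_lintegral_mul _ (measurable_gammaPDF _ r) hg,
    ← lintegral_const_mul _ ((measurable_gammaPDF _ r).mul hg)]
  refine lintegral_congr fun x => ?_
  have h := ofReal_mul_gammaPDF ha hr x
  simp only [Pi.mul_apply]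
  rw [← mul_assoc (ENNReal.ofReal (a / r)), ← h]
  ring

/-- Used at `s = -15 * r` to control the lower tail and at `s = r / 2` for the maximum of the
values. -/
theorem lintegral_exp_gammaMeasure {a r s : ℝ} (ha : 0 < a) (hr : 0 < r) (hs : s < r) :
    ∫⁻ x, ENNReal.ofReal (Real.exp (s * x)) ∂gammaMeasure a r =
      ENNReal.ofReal ((r / (r - s)) ^ a) := by
  rw [gammaMeasure, lintegral_withDensity_eq_lintegral_mul _ (measurable_gammaPDF a r)
    (by fun_prop)]
  simp only [Pi.mul_apply]
  simp_rw [mul_comm (gammaPDF a r _), ofReal_exp_mul_gammaPDF hr hs]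
  rw [lintegral_const_mul _ (measurable_gammaPDF a _),
    lintegral_gammaPDF_eq_one ha (sub_pos.2 hs), mul_one]

theorem ae_nonneg_gammaMeasure (a r : ℝ) : ∀ᵐ x ∂gammaMeasure a r, 0 ≤ x := by
  rw [ae_iff, gammaMeasure]
  simp only [not_le]
  change (volume.withDensity (gammaPDF a r)) (Set.Iio 0) = 0
  rw [withDensity_apply _ measurableSet_Iio, lintegral_gammaPDF_of_nonpos le_rfl]

instance nullSingletonClass_gammaMeasure (a r : ℝ) : NullSingletonClass (gammaMeasure a r) := by
  unfold gammaMeasure; infer_instance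

theorem lintegral_ofReal_gammaMeasure {a r : ℝ} (ha : 0 < a) (hr : 0 < r) :
    ∫⁻ x, ENNReal.ofReal x ∂gammaMeasure a r = ENNReal.ofReal (a / r) := by
  have := isProbabilityMeasure_gammaMeasure (add_pos ha one_pos) hr
  simpa using lintegral_ofReal_mul_gammaMeasure ha hr (g := fun _ => 1) measurable_const

theorem lintegral_ofReal_sq_gammaMeasure {a r : ℝ} (ha : 0 < a) (hr : 0 < r) :
    ∫⁻ x, ENNReal.ofReal (x ^ 2) ∂gammaMeasure a r = ENNReal.ofReal (a * (a + 1) / r ^ 2) := by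
  have h := lintegral_ofReal_mul_gammaMeasure ha hr (g := ENNReal.ofReal) (by fun_prop)
  rw [lintegral_ofReal_gammaMeasure (by positivity) hr, ← ENNReal.ofReal_mul (by positivity)] at h
  rw [show a * (a + 1) / r ^ 2 = a / r * ((a + 1) / r) by field_simp, ← h]
  refine lintegral_congr_ae ?_
  filter_upwards [ae_nonneg_gammaMeasure a r] with x hx
  rw [pow_two, ENNReal.ofReal_mul hx]

theorem integral_id_gammaMeasure {a r : ℝ} (ha : 0 < a) (hr : 0 < r) :
    ∫ x, x ∂gammaMeasure a r = a / r := by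
  rw [integral_eq_lintegral_of_nonneg_ae (ae_nonneg_gammaMeasure a r) (by fun_prop),
    lintegral_ofReal_gammaMeasure ha hr, ENNReal.toReal_ofReal (by positivity)]

theorem integral_sq_gammaMeasure {a r : ℝ} (ha : 0 < a) (hr : 0 < r) :
    ∫ x, x ^ 2 ∂gammaMeasure a r = a * (a + 1) / r ^ 2 := by
  rw [integral_eq_lintegral_of_nonneg_ae (.of_forall fun x => sq_nonneg x) (by fun_prop),
    lintegral_ofReal_sq_gammaMeasure ha hr, ENNReal.toReal_ofReal (by positivity)]

theorem variance_id_gammaMeasure {a r : ℝ} (ha : 0 < a) (hr : 0 < r) :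
    variance id (gammaMeasure a r) = a / r ^ 2 := by
  have := isProbabilityMeasure_gammaMeasure ha hr
  have hL : MemLp id 2 (gammaMeasure a r) := by
    rw [memLp_two_iff_integrable_sq (by fun_prop)]
    refine ⟨by fun_prop, ?_⟩
    rw [hasFiniteIntegral_iff_ofReal (.of_forall fun x => sq_nonneg _)]
    simp only [id]
    rw [lintegral_ofReal_sq_gammaMeasure ha hr]
    exact ENNReal.ofReal_lt_top
  rw [variance_eq_sub hL]
  simp only [id, Pi.pow_apply]
  rw [integral_sq_gammaMeasure ha hr, integral_id_gammaMeasure ha hr]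
  field_simp
  ring

/-! ### The median of a gamma distribution. -/

/-- More than half of the mass of a gamma distribution of shape at least `1 / 2` lies above a
thirtieth of the mean. -/
theorem half_lt_gammaMeasure_Ici {a r : ℝ} (ha : 1 / 2 ≤ a) (hr : 0 < r) :
    1 / 2 < (gammaMeasure a r).real (Set.Ici (a / r / 30)) := by
  have ha0 : 0 < a := by linarith
  have := isProbabilityMeasure_gammaMeasure ha0 hr
  -- Chernoff bound: `exp (a / 2 - 15 * r * x) ≥ 1` below `a / r / 30`, and its expectation is `(exp
  -- (1 / 2) / 16) ^ a`, where `exp (1 / 2) ≤ 2`.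
  have hle : gammaMeasure a r (Set.Iio (a / r / 30)) ≤ ENNReal.ofReal ((1 / 8) ^ a) := by
    calc gammaMeasure a r (Set.Iio (a / r / 30))
        = ∫⁻ x, (Set.Iio (a / r / 30)).indicator 1 x ∂gammaMeasure a r := by
          rw [lintegral_indicator_one measurableSet_Iio]
      _ ≤ ∫⁻ x, ENNReal.ofReal (Real.exp (a / 2)) * ENNReal.ofReal (Real.exp ((-(15 * r)) * x))
            ∂gammaMeasure a r := by
          refine lintegral_mono fun x => ?_
          by_cases hx : x ∈ Set.Iio (a / r / 30)
          · rw [Set.indicator_of_mem hx, Pi.one_apply, ← ENNReal.ofReal_mul (by positivity),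
              ← Real.exp_add, ← ENNReal.ofReal_one]
            refine ENNReal.ofReal_le_ofReal (Real.one_le_exp ?_)
            have h : x * r ≤ a / r / 30 * r := mul_le_mul_of_nonneg_right (le_of_lt hx) hr.le
            have h' : a / r / 30 * r = a / 30 := by field_simp
            linarith
          · rw [Set.indicator_of_notMem hx]; exact zero_le
      _ = ENNReal.ofReal (Real.exp (a / 2)) * ENNReal.ofReal ((1 / 16) ^ a) := by
          rw [lintegral_const_mul _ (by fun_prop),
            lintegral_exp_gammaMeasure ha0 hr (by linarith)]
          rw [show r / (r - -(15 * r)) = 1 / 16 by rw [sub_neg_eq_add]; field_simp; norm_num]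
      _ ≤ ENNReal.ofReal ((1 / 8) ^ a) := by
          rw [← ENNReal.ofReal_mul (by positivity)]
          refine ENNReal.ofReal_le_ofReal ?_
          have h1 : Real.exp (a / 2) = Real.exp (1 / 2) ^ a := by
            rw [← Real.exp_mul]; ring_nf
          have h2 : Real.exp (1 / 2) ≤ 2 := by
            have h3 : Real.exp (1 / 2) ^ 2 = Real.exp 1 := by
              rw [← Real.exp_nat_mul]; norm_num
            nlinarith [Real.exp_one_lt_three, Real.exp_pos (1 / 2)]
          rw [h1, ← Real.mul_rpow (by positivity) (by norm_num)]
          exact Real.rpow_le_rpow (by positivity) (by linarith) ha0.le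
  -- The only use of `a ≥ 1/2` here: the worst case is `(1 / 8) ^ (1 / 2) < (1 / 4) ^ (1 / 2) = 1 /
  -- 2`.
  have hlt : ((1 : ℝ) / 8) ^ a < 1 / 2 := by
    have h1 : ((1 : ℝ) / 8) ^ a ≤ (1 / 8) ^ (1 / 2 : ℝ) :=
      Real.rpow_le_rpow_of_exponent_ge (by norm_num) (by norm_num) ha
    have h2 : ((1 : ℝ) / 8) ^ (1 / 2 : ℝ) < (1 / 4) ^ (1 / 2 : ℝ) :=
      Real.rpow_lt_rpow (by norm_num) (by norm_num) (by norm_num)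
    have h3 : ((1 : ℝ) / 4) ^ (1 / 2 : ℝ) = 1 / 2 := by
      rw [← Real.sqrt_eq_rpow, show (1 : ℝ) / 4 = (1 / 2) ^ 2 by norm_num,
        Real.sqrt_sq (by norm_num)]
    linarith
  have hreal : (gammaMeasure a r).real (Set.Iio (a / r / 30)) ≤ (1 / 8) ^ a :=
    ENNReal.toReal_le_of_le_ofReal (by positivity) hle
  rw [← Set.compl_Iio, probReal_compl_eq_one_sub measurableSet_Iio]
  linarith

theorem continuous_measureReal_Ici {F : Measure ℝ} [IsProbabilityMeasure F] [NullSingletonClass F] :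
    Continuous fun x => F.real (Set.Ici x) := by
  have hcdf : Continuous (cdf F) := by
    refine continuous_iff_continuousAt.2 fun x => ?_
    rw [continuousAt_iff_continuous_left_right]
    refine ⟨?_, (cdf F).right_continuous x⟩
    -- The mass of a point is the jump of the cdf there, so the absence of atoms gives left
    -- continuity.
    have h := StieltjesFunction.measure_singleton (cdf F) x
    rw [measure_cdf, measure_singleton, eq_comm, ENNReal.ofReal_eq_zero, sub_nonpos] at h
    rw [← continuousWithinAt_Iio_iff_Iic, Monotone.continuousWithinAt_Iio_iff_leftLim_eq (cdf F).mono]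
    exact le_antisymm (Monotone.leftLim_le (cdf F).mono le_rfl) h
  have h : (fun x => F.real (Set.Ici x)) = fun x => 1 - cdf F x := by
    ext x
    rw [cdf_eq_real, ← Set.compl_Iio, probReal_compl_eq_one_sub measurableSet_Iio,
      measureReal_congr Iio_ae_eq_Iic]
  rw [h]
  fun_prop

/-- A gamma distribution of shape at least `1 / 2` has a median that is at least a thirtieth of
its mean. -/
theorem exists_median_gammaMeasure {a r : ℝ} (ha : 1 / 2 ≤ a) (hr : 0 < r) :
    ∃ l, a / r / 30 ≤ l ∧ (gammaMeasure a r).real (Set.Ici l) = 1 / 2 := by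
  have ha0 : 0 < a := by linarith
  have := isProbabilityMeasure_gammaMeasure ha0 hr
  have hlim : Filter.Tendsto (fun x => 1 - cdf (gammaMeasure a r) x) Filter.atTop (nhds 0) := by
    simpa using (tendsto_cdf_atTop (gammaMeasure a r)).const_sub 1
  obtain ⟨y, hy, hy'⟩ := ((hlim.eventually (gt_mem_nhds (show (0 : ℝ) < 1 / 2 by norm_num))).and
    (Filter.eventually_ge_atTop (a / r / 30))).exists
  have hIci : (gammaMeasure a r).real (Set.Ici y) ≤ 1 / 2 := by
    rw [cdf_eq_real, ← measureReal_congr (Iio_ae_eq_Iic (μ := gammaMeasure a r)),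
      ← probReal_compl_eq_one_sub measurableSet_Iio, Set.compl_Iio] at hy
    exact hy.le
  obtain ⟨l, hl, hl'⟩ := intermediate_value_Icc' hy'
    (continuous_measureReal_Ici (F := gammaMeasure a r)).continuousOn
    ⟨hIci, (half_lt_gammaMeasure_Ici ha hr).le⟩
  exact ⟨l, hl.1, hl'⟩

end Gamma

namespace Voting

variable {n m : ℕ}

/-! ### Rankings and the welfare guarantee of Mean. -/

theorem pos_injective (r : Ranking m) : Function.Injective (pos r) := fun a b h =>
  r.injective (Fin.ext (by simpa [pos] using h))

theorem exists_pos_eq (r : Ranking m) {k : ℕ} (h1 : 1 ≤ k) (hk : k ≤ m) : ∃ b, pos r b = k :=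
  ⟨r.symm ⟨k - 1, by omega⟩, by simp [pos]; omega⟩

theorem card_filter_pos_le (r : Ranking m) {k : ℕ} (hk : k ≤ m) :
    (Finset.univ.filter fun a => pos r a ≤ k).card = k := by
  have h : (Finset.univ.filter fun a => pos r a ≤ k) =
      (Finset.univ.filter fun j : Fin m => (j : ℕ) < k).map r.symm.toEmbedding := by
    ext a
    simp [pos]
  rw [h, Finset.card_map, Fin.card_filter_val_lt, min_eq_right hk]

theorem Consistent.le_of_pos_le {P : Profile n m} {v : Valuation n m} (h : Consistent P v)
    {i : Fin n} {a b : Fin m} (hab : pos (P i) a ≤ pos (P i) b) : v i b ≤ v i a := by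
  rcases hab.lt_or_eq with h' | h'
  · exact h i a b h'
  · rw [pos_injective _ h']

theorem binarize_eq_one_iff {l : ℝ} {v : Valuation n m} {i : Fin n} {a : Fin m} :
    binarize l v i a = 1 ↔ l ≤ v i a := by
  simp [binarize]

/-- If an agent has at least `k` values that are at least `l`, then her value for the alternative
at position `k` is at least `l`. -/
theorem Consistent.le_of_le_card {P : Profile n m} {v : Valuation n m} (h : Consistent P v)
    {i : Fin n} {l : ℝ} {k : ℕ} {b : Fin m} (hb : pos (P i) b = k)
    (hk : k ≤ (Finset.univ.filter fun a => l ≤ v i a).card) : l ≤ v i b := by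
  have h1 : 1 ≤ k := by simp only [pos] at hb; omega
  have hkm : k ≤ m := hk.trans ((Finset.card_le_univ _).trans (by simp))
  by_contra hlt
  -- If the value at position `k` is below `l`, only the `k - 1` positions above it can hold values
  -- at least `l`.
  have hsub : (Finset.univ.filter fun a => l ≤ v i a) ⊆
      Finset.univ.filter fun a => pos (P i) a ≤ k - 1 := by
    intro a ha
    simp only [Finset.mem_filter, Finset.mem_univ, true_and] at ha ⊢
    by_contra hpos
    exact hlt (ha.trans (h.le_of_pos_le (by omega)))
  have := Finset.card_le_card hsub
  rw [card_filter_pos_le _ (by omega)] at this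
  omega

/-- The welfare of an alternative is at least the threshold times its implied welfare for the
binarized valuations. -/
theorem Consistent.mul_impliedSW_le_sw {P : Profile n m} {v : Valuation n m}
    (h : Consistent P v) (hv : ∀ i a, 0 ≤ v i a) (l : ℝ) (a : Fin m) (k : ℕ) :
    l * impliedSW a P (binarize l v) k ≤ sw a v := by
  classical
  rw [impliedSW, sw, Nat.cast_sum, Finset.mul_sum]
  refine Finset.sum_le_sum fun i _ => ?_
  split_ifs with hi
  · obtain ⟨⟨b, hb, hb1⟩, ha⟩ := hi
    rw [binarize_eq_one_iff] at hb1
    simpa using hb1.trans (h.le_of_pos_le (ha.trans hb.ge))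
  · simpa using hv i a

open scoped Classical in
/-- The number of agents that have at least `k` values that are at least `l`. -/
noncomputable def numSatisfied (l : ℝ) (k : ℕ) (v : Valuation n m) : ℕ :=
  ∑ i, if k ≤ (Finset.univ.filter fun a => l ≤ v i a).card then 1 else 0

/-- Double counting: an agent with `k` values above `l` answers `1` and supports exactly the `k`
alternatives at the top of her ranking. -/
theorem Consistent.mul_numSatisfied_le_sum {P : Profile n m} {v : Valuation n m}
    (h : Consistent P v) (l : ℝ) {k : ℕ} (h1 : 1 ≤ k) (hk : k ≤ m) :
    k * numSatisfied l k v ≤ ∑ a, impliedSW a P (binarize l v) k := by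
  classical
  simp only [impliedSW, numSatisfied]
  rw [Finset.sum_comm, Finset.mul_sum]
  refine Finset.sum_le_sum fun i _ => ?_
  split_ifs with hi
  · obtain ⟨b, hb⟩ := exists_pos_eq (P i) h1 hk
    have hb' : ∃ b, pos (P i) b = k ∧ binarize l v i b = 1 :=
      ⟨b, hb, binarize_eq_one_iff.2 (h.le_of_le_card hb (by convert hi))⟩
    simp only [hb', true_and, mul_one]
    rw [← Finset.card_filter, card_filter_pos_le _ hk]
  · simp

/-- A lower bound on the welfare of the alternative returned by Mean. -/
theorem IsMean.mul_numSatisfied_le_sw {M : ℝ → Mechanism n m} (hM : IsMean M)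
    {P : Profile n m} {v : Valuation n m} (h : Consistent P v) (hv : ∀ i a, 0 ≤ v i a)
    {l : ℝ} (hl : 0 ≤ l) {p : ℝ} (hp : p ∈ Set.Icc (0 : ℝ) 1) (hm : 0 < m) :
    l * (queryPos p m / m) * numSatisfied l (queryPos p m) v ≤
      sw (M p P (binarize l v)) v := by
  have h1 : 1 ≤ queryPos p m := le_max_left _ _
  have hk : queryPos p m ≤ m := max_le hm <| Nat.floor_le_of_le <|
    mul_le_of_le_one_left (Nat.cast_nonneg m) hp.2
  have hsum : queryPos p m * numSatisfied l (queryPos p m) v ≤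
      m * impliedSW (M p P (binarize l v)) P (binarize l v) (queryPos p m) := by
    refine (h.mul_numSatisfied_le_sum l h1 hk).trans ?_
    calc _ ≤ ∑ _a : Fin m,
          impliedSW (M p P (binarize l v)) P (binarize l v) (queryPos p m) :=
          Finset.sum_le_sum fun a _ => hM p hp P (binarize l v) a
      _ = _ := by simp
  have hsum' : (queryPos p m : ℝ) * numSatisfied l (queryPos p m) v ≤
      m * impliedSW (M p P (binarize l v)) P (binarize l v) (queryPos p m) := by
    exact_mod_cast hsum
  have hm' : (0 : ℝ) < m := by exact_mod_cast hm
  refine le_trans ?_ (h.mul_impliedSW_le_sw hv l _ (queryPos p m))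
  rw [mul_assoc]
  refine mul_le_mul_of_nonneg_left ?_ hl
  rw [div_mul_eq_mul_div, div_le_iff₀ hm']
  linarith

/-! ### Probability that an agent has many values above the median. -/

/-- The law of a fair coin is invariant under exchanging its two sides. -/
theorem map_not_of_fair {ν : Measure Bool} (h : ν {true} = ν {false}) : ν.map not = ν := by
  refine Measure.ext_of_singleton fun b => ?_
  rw [Measure.map_apply (measurable_of_countable _) (measurableSet_singleton b)]
  have hb : not ⁻¹' {b} = {!b} := by ext c; cases b <;> cases c <;> simp
  rw [hb]
  cases b <;> simp [h]

/-- Among `m` independent tosses of a fair coin, at least half are heads with probability at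
least `1 / 2`. -/
theorem half_le_pi_fair {ν : Measure Bool} [IsProbabilityMeasure ν] (h : ν {true} = ν {false})
    {k : ℕ} (hk : 2 * k ≤ m) :
    1 / 2 ≤ (Measure.pi fun _ : Fin m => ν)
      {c | k ≤ (Finset.univ.filter fun a => c a = true).card} := by
  set μ := Measure.pi fun _ : Fin m => ν with hμ
  set A := {c : Fin m → Bool | k ≤ (Finset.univ.filter fun a => c a = true).card} with hA
  have hflip : μ.map (fun c a => !c a) = μ := by
    have : IsProbabilityMeasure (ν.map not) := by rwa [map_not_of_fair h]
    rw [hμ, Measure.pi_map_pi (μ := fun _ => ν) (f := fun _ => not)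
      (fun _ => (measurable_of_countable _).aemeasurable), map_not_of_fair h]
  have hAm : MeasurableSet A := (Set.toFinite A).measurableSet
  have hA' : μ ((fun c a => !c a) ⁻¹' A) = μ A := by
    rw [← Measure.map_apply (measurable_of_countable _) hAm, hflip]
  -- Heads and tails add up to `m ≥ 2 * k`, so one of the two occurs at least `k` times.
  have hcover : A ∪ (fun c a => !c a) ⁻¹' A = Set.univ := by
    refine Set.eq_univ_of_forall fun c => ?_
    have hcard := Finset.card_filter_add_card_filter_not (s := (Finset.univ : Finset (Fin m)))
      (fun a => c a = true)
    simp only [Finset.card_univ, Fintype.card_fin, Bool.not_eq_true] at hcard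
    simp only [hA, Set.mem_union, Set.mem_preimage, Set.mem_ofPred_eq, Bool.not_eq_true']
    omega
  have h1 : 1 ≤ 2 * μ A := by
    calc (1 : ℝ≥0∞) = μ (A ∪ (fun c a => !c a) ⁻¹' A) := by rw [hcover, measure_univ]
      _ ≤ μ A + μ ((fun c a => !c a) ⁻¹' A) := measure_union_le _ _
      _ = 2 * μ A := by rw [hA', two_mul]
  rw [ENNReal.div_le_iff_le_mul (by simp) (by simp), mul_comm]
  exact h1

theorem measurableSet_le_card (l : ℝ) (k : ℕ) :
    MeasurableSet {x : Fin m → ℝ | k ≤ (Finset.univ.filter fun a => l ≤ x a).card} := by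
  have h : Measurable fun x : Fin m → ℝ => (Finset.univ.filter fun a => l ≤ x a).card := by
    simp only [Finset.card_filter]
    refine Finset.measurable_sum _ fun a _ => ?_
    exact Measurable.ite (measurableSet_le measurable_const (measurable_pi_apply a))
      measurable_const measurable_const
  exact h measurableSet_Ici

/-- If `l` is a median of `F`, then at least half of `m` independent values drawn from `F` are at
least `l` with probability at least `1 / 2`. -/
theorem half_le_pi_median {F : Measure ℝ} [IsProbabilityMeasure F] {l : ℝ}
    (hl : F.real (Set.Ici l) = 1 / 2) {k : ℕ} (hk : 2 * k ≤ m) :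
    1 / 2 ≤ (Measure.pi fun _ : Fin m => F)
      {x | k ≤ (Finset.univ.filter fun a => l ≤ x a).card} := by
  classical
  set b : ℝ → Bool := fun x => decide (l ≤ x) with hb
  have hbm : Measurable b := measurable_to_bool (by
    have : b ⁻¹' {true} = Set.Ici l := by ext x; simp [hb]
    rw [this]; exact measurableSet_Ici)
  have : IsProbabilityMeasure (F.map b) := Measure.isProbabilityMeasure_map hbm.aemeasurable
  have hfair : (F.map b) {true} = (F.map b) {false} := by
    rw [Measure.map_apply hbm (measurableSet_singleton _),
      Measure.map_apply hbm (measurableSet_singleton _)]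
    have h1 : b ⁻¹' {true} = Set.Ici l := by ext x; simp [hb]
    have h2 : b ⁻¹' {false} = (Set.Ici l)ᶜ := by ext x; simp [hb]
    rw [h1, h2, ← measureReal_eq_measureReal_iff,
      probReal_compl_eq_one_sub measurableSet_Ici, hl]
    norm_num
  have h := half_le_pi_fair hfair hk
  rw [← Measure.pi_map_pi (μ := fun _ : Fin m => F) (f := fun _ => b)
      (fun _ => hbm.aemeasurable),
    Measure.map_apply (by fun_prop) (Set.toFinite _).measurableSet] at h
  simpa [hb] using h

/-- The expected value of a sum over the agents, which are identically distributed. -/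
theorem lintegral_valuationLaw_sum {F : Measure ℝ} [IsProbabilityMeasure F]
    {f : (Fin m → ℝ) → ℝ≥0∞} (hf : Measurable f) :
    ∫⁻ v, ∑ i, f (v i) ∂valuationLaw n m F =
      n * ∫⁻ x, f x ∂Measure.pi fun _ : Fin m => F := by
  have h : ∀ i : Fin n, ∫⁻ v, f (v i) ∂valuationLaw n m F =
      ∫⁻ x, f x ∂Measure.pi fun _ : Fin m => F := fun i =>
    (measurePreserving_eval (fun _ : Fin n => Measure.pi fun _ : Fin m => F) i).lintegral_comp hf
  rw [lintegral_finsetSum (f := fun i (v : Valuation n m) => f (v i)) _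
    fun i _ => hf.comp (measurable_pi_apply i)]
  simp [h]

/-- The expected number of agents that have at least half of their values above the median. -/
theorem half_le_lintegral_numSatisfied {F : Measure ℝ} [IsProbabilityMeasure F] {l : ℝ}
    (hl : F.real (Set.Ici l) = 1 / 2) {k : ℕ} (hk : 2 * k ≤ m) :
    n * (1 / 2 : ℝ≥0∞) ≤ ∫⁻ v : Valuation n m, numSatisfied l k v ∂valuationLaw n m F := by
  classical
  set A := {x : Fin m → ℝ | k ≤ (Finset.univ.filter fun a => l ≤ x a).card} with hA
  have hAm : MeasurableSet A := measurableSet_le_card l k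
  have hind : ∀ v : Valuation n m, (numSatisfied l k v : ℝ≥0∞) =
      ∑ i, A.indicator (fun _ => (1 : ℝ≥0∞)) (v i) := by
    intro v
    rw [numSatisfied, Nat.cast_sum]
    refine Finset.sum_congr rfl fun i _ => ?_
    simp only [hA, Set.indicator_apply, Set.mem_ofPred_eq]
    split_ifs <;> simp_all
  have hm : Measurable (A.indicator fun _ => (1 : ℝ≥0∞)) := measurable_const.indicator hAm
  simp_rw [hind]
  rw [lintegral_valuationLaw_sum hm, lintegral_indicator_const hAm, one_mul]
  gcongr
  exact half_le_pi_median hl hk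

theorem ae_nonneg_valuationLaw {F : Measure ℝ} [IsProbabilityMeasure F] (h : ∀ᵐ x ∂F, 0 ≤ x) :
    ∀ᵐ v ∂valuationLaw n m F, ∀ i a, 0 ≤ v i a := by
  rw [ae_all_iff]
  intro i
  refine (measurePreserving_eval (fun _ : Fin n => Measure.pi fun _ : Fin m => F)
    i).quasiMeasurePreserving.ae (p := fun x => ∀ a, 0 ≤ x a) ?_
  rw [ae_all_iff]
  intro a
  exact (measurePreserving_eval (fun _ : Fin m => F) a).quasiMeasurePreserving.ae h

/-! ### Expected welfare of RtMean with the median as threshold. -/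

/-- The parameters of RtMean with the single threshold `l`. -/
def Thresholds.single (l : ℝ) (hl : 0 < l) : Thresholds where
  k := 1
  k_pos := one_pos
  ℓ _ := l
  ℓ_pos _ := hl
  ℓ_strictMono := Subsingleton.strictMono _

theorem sum_rtMean_single (M : ℝ → Mechanism n m) {l : ℝ} (hl : 0 < l) (F : Measure ℝ)
    (P : Profile n m) (v : Valuation n m) (f : Fin m → ℝ≥0∞) :
    ∑ a, rtMean M (Thresholds.single l hl) F P v a * f a =
      f (M (F.real (Set.Ici l)) P (binarize l v)) := by
  have h : rtMean M (Thresholds.single l hl) F P v =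
      PMF.pure (M (F.real (Set.Ici l)) P (binarize l v)) := by
    simp only [rtMean, Thresholds.single]
    exact PMF.map_const _ _
  simp [h, PMF.pure_apply]

/-- Equality holds at `m = 3`, where the queried position is `1`. -/
theorem third_le_queryPos_half_div (hm : 2 ≤ m) : (1 / 3 : ℝ) ≤ queryPos (1 / 2) m / m := by
  have hm' : (0 : ℝ) < m := by positivity
  have hfl : ⌊(1 / 2 : ℝ) * m⌋₊ = m / 2 := by
    rw [one_div_mul_eq_div]; exact_mod_cast Nat.floor_div_eq_div (K := ℝ) m 2
  rw [le_div_iff₀ hm', queryPos, hfl]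
  have : m ≤ 3 * max 1 (m / 2) := by omega
  have : (m : ℝ) ≤ 3 * (max 1 (m / 2) : ℕ) := by exact_mod_cast this
  linarith

theorem two_mul_queryPos_half_le (hm : 2 ≤ m) : 2 * queryPos (1 / 2) m ≤ m := by
  have hfl : ⌊(1 / 2 : ℝ) * m⌋₊ = m / 2 := by
    rw [one_div_mul_eq_div]; exact_mod_cast Nat.floor_div_eq_div (K := ℝ) m 2
  rw [queryPos, hfl]
  omega

/-- With the median as its single threshold, RtMean obtains in expectation a constant fraction of
the median per agent. -/
theorem le_expectedWelfare_rtMean_median {F : Measure ℝ} [IsProbabilityMeasure F]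
    (hF : ∀ᵐ x ∂F, 0 ≤ x) {l : ℝ} (hl : 0 < l) (hmed : F.real (Set.Ici l) = 1 / 2)
    (hm : 2 ≤ m) {M : ℝ → Mechanism n m} (hM : IsMean M) :
    ENNReal.ofReal (n * (l / 6)) ≤ expectedWelfare (rtMean M (Thresholds.single l hl) F) F := by
  calc ENNReal.ofReal (n * (l / 6))
      = ENNReal.ofReal (l / 3) * (n * (1 / 2 : ℝ≥0∞)) := by
        rw [show (n * (1 / 2 : ℝ≥0∞)) = ENNReal.ofReal (n * (1 / 2)) by
          rw [ENNReal.ofReal_mul (by positivity), ENNReal.ofReal_natCast]; simp,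
          ← ENNReal.ofReal_mul (by positivity)]
        congr 1
        ring
    _ ≤ ENNReal.ofReal (l / 3) *
        ∫⁻ v : Valuation n m, numSatisfied l (queryPos (1 / 2) m) v ∂valuationLaw n m F := by
        gcongr
        exact half_le_lintegral_numSatisfied hmed (two_mul_queryPos_half_le hm)
    _ = ∫⁻ v : Valuation n m, ENNReal.ofReal (l / 3) * numSatisfied l (queryPos (1 / 2) m) v
          ∂valuationLaw n m F := (lintegral_const_mul' _ _ ENNReal.ofReal_ne_top).symm
    _ ≤ _ := by
        rw [expectedWelfare]
        refine lintegral_mono_ae ?_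
        filter_upwards [ae_nonneg_valuationLaw hF] with v hv
        simp_rw [sum_rtMean_single, hmed]
        calc ENNReal.ofReal (l / 3) * numSatisfied l (queryPos (1 / 2) m) v
            = ∑ P, randomProfile v P *
                (ENNReal.ofReal (l / 3) * numSatisfied l (queryPos (1 / 2) m) v) := by
              -- The bound does not depend on `P`, so it can be averaged over the random profile,
              -- whose weights sum to `1`.
              rw [← Finset.sum_mul, ← tsum_fintype (L := .unconditional _), PMF.tsum_coe, one_mul]
          _ ≤ _ := by
              refine Finset.sum_le_sum fun P _ => ?_
              by_cases hP : P ∈ consistentProfiles v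
              · gcongr
                rw [← ENNReal.ofReal_natCast, ← ENNReal.ofReal_mul (by positivity)]
                refine ENNReal.ofReal_le_ofReal ?_
                have hc : Consistent P v := by
                  simpa [consistentProfiles] using hP
                refine le_trans ?_ (hM.mul_numSatisfied_le_sw hc hv hl.le
                  (p := 1 / 2) (by norm_num) (by omega))
                refine mul_le_mul_of_nonneg_right ?_ (Nat.cast_nonneg _)
                have := mul_le_mul_of_nonneg_left (third_le_queryPos_half_div hm) hl.le
                linarith
              · rw [randomProfile, PMF.uniformOfFinset_apply_of_notMem _ hP]
                simp

/-! ### Upper bound on the expected maximum welfare. -/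

/-- The expected maximum welfare is at most the number of agents times the expected maximum value
of one agent. -/
theorem expectedMaxWelfare_le_mul {F : Measure ℝ} [IsProbabilityMeasure F] :
    expectedMaxWelfare n m F ≤
      n * ∫⁻ x, ⨆ a, ENNReal.ofReal (x a) ∂Measure.pi fun _ : Fin m => F := by
  have hmeas : Measurable fun x : Fin m → ℝ => ⨆ a, ENNReal.ofReal (x a) :=
    Measurable.iSup fun a => (measurable_pi_apply a).ennreal_ofReal
  calc expectedMaxWelfare n m F
      ≤ ∫⁻ v, ∑ i, ⨆ a, ENNReal.ofReal (v i a) ∂valuationLaw n m F := by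
        refine lintegral_mono fun v => iSup_le fun a => ?_
        rw [sw]
        refine (Finset.le_sum_of_subadditive ENNReal.ofReal ENNReal.ofReal_zero.le
          (fun _ _ => ENNReal.ofReal_add_le) _ _).trans (Finset.sum_le_sum fun i _ => ?_)
        exact le_iSup (fun a => ENNReal.ofReal (v i a)) a
    _ = _ := lintegral_valuationLaw_sum hmeas

/-- A maximal inequality: the expected maximum of `m` values, in terms of the moment generating
function. -/
theorem lintegral_iSup_le {F : Measure ℝ} [IsProbabilityMeasure F] {s t K : ℝ} (hs : 0 < s)
    (hK : 0 ≤ K) (ht : 0 ≤ t)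
    (hF : ∫⁻ x, ENNReal.ofReal (Real.exp (s * x)) ∂F ≤ ENNReal.ofReal K) :
    ∫⁻ x, ⨆ a, ENNReal.ofReal (x a) ∂(Measure.pi fun _ : Fin m => F) ≤
      ENNReal.ofReal (t + m * (Real.exp (-(s * t)) / s * K)) := by
  -- This is `1 + u ≤ exp u` at `u = s * (x - t)`. Summing the exponential term over the
  -- alternatives then bounds the maximum.
  have hx : ∀ x : ℝ, x ≤ t + Real.exp (-(s * t)) / s * Real.exp (s * x) := by
    intro x
    have h1 := Real.add_one_le_exp (s * (x - t))
    have h2 : Real.exp (-(s * t)) / s * Real.exp (s * x) = Real.exp (s * (x - t)) / s := by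
      rw [div_mul_eq_mul_div, ← Real.exp_add]; ring_nf
    rw [h2, ← sub_le_iff_le_add', le_div_iff₀ hs]
    linarith
  have hpt : ∀ x : Fin m → ℝ, ⨆ a, ENNReal.ofReal (x a) ≤ ENNReal.ofReal t +
      ∑ a, ENNReal.ofReal (Real.exp (-(s * t)) / s) * ENNReal.ofReal (Real.exp (s * x a)) := by
    refine fun x => iSup_le fun a => ?_
    refine (ENNReal.ofReal_le_ofReal (hx (x a))).trans ?_
    rw [ENNReal.ofReal_add ht (by positivity), ENNReal.ofReal_mul (by positivity)]
    gcongr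
    exact Finset.single_le_sum (f := fun a => ENNReal.ofReal (Real.exp (-(s * t)) / s) *
      ENNReal.ofReal (Real.exp (s * x a))) (fun _ _ => zero_le) (Finset.mem_univ a)
  have hmg : Measurable fun y : ℝ => ENNReal.ofReal (Real.exp (s * y)) := by fun_prop
  refine (lintegral_mono hpt).trans ?_
  rw [lintegral_add_left measurable_const, lintegral_const, measure_univ, mul_one,
    lintegral_finsetSum _ fun a _ => by fun_prop,
    ENNReal.ofReal_add ht (by positivity), ENNReal.ofReal_mul (by positivity),
    ENNReal.ofReal_natCast]
  gcongr
  calc _ ≤ ∑ _a : Fin m, ENNReal.ofReal (Real.exp (-(s * t)) / s * K) := by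
        refine Finset.sum_le_sum fun a _ => ?_
        rw [lintegral_const_mul _ (by fun_prop), ENNReal.ofReal_mul (by positivity)]
        gcongr
        rwa [(measurePreserving_eval (fun _ : Fin m => F) a).lintegral_comp hmg]
    _ = _ := by simp

theorem expectedMaxWelfare_gammaMeasure_le {a r : ℝ} (ha : 0 < a) (hr : 0 < r) (hm : 1 ≤ m) :
    expectedMaxWelfare n m (gammaMeasure a r) ≤
      ENNReal.ofReal (n * (2 / r * (Real.log m + a * Real.log 2 + 1))) := by
  have := isProbabilityMeasure_gammaMeasure ha hr
  have hm0 : (0 : ℝ) < m := by exact_mod_cast hm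
  have hlog : 0 ≤ Real.log m := Real.log_nonneg (by exact_mod_cast hm)
  have hlog2 : 0 ≤ Real.log 2 := Real.log_nonneg (by norm_num)
  -- Chosen so that `m * 2 ^ a * exp (-(r / 2) * t) = 1`; the exponential term then contributes just
  -- `2 / r`.
  set t := 2 / r * (Real.log m + a * Real.log 2) with ht
  have hexp : Real.exp (-(r / 2 * t)) = 1 / (m * 2 ^ a) := by
    have : r / 2 * t = Real.log m + Real.log 2 * a := by rw [ht]; field_simp
    rw [this, Real.exp_neg, Real.exp_add, Real.exp_log hm0, Real.rpow_def_of_pos two_pos, one_div]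
  have hmax := lintegral_iSup_le (m := m) (F := gammaMeasure a r) (s := r / 2) (t := t)
    (K := 2 ^ a) (by positivity) (by positivity) (by positivity)
    (by rw [lintegral_exp_gammaMeasure ha hr (by linarith),
          show r / (r - r / 2) = 2 by rw [sub_half]; field_simp])
  refine expectedMaxWelfare_le_mul.trans ?_
  rw [ENNReal.ofReal_mul (Nat.cast_nonneg n), ENNReal.ofReal_natCast]
  gcongr
  refine hmax.trans (le_of_eq ?_)
  congr 1
  have h2a : (2 : ℝ) ^ a ≠ 0 := by positivity
  rw [hexp, ht]
  field_simp

/-! ### The distortion bound and the three families. -/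

/-- With the median as its single threshold, RtMean has logarithmic distortion for the gamma
distributions of shape at least `1 / 2`. -/
theorem exists_thresholds_gammaMeasure {a r : ℝ} (ha : 1 / 2 ≤ a) (hr : 0 < r) :
    ∃ T : Thresholds, ∀ m : ℕ, 2 ≤ m → ∀ n : ℕ, 1 ≤ n → ∀ M : ℝ → Mechanism n m, IsMean M →
      expectedMaxWelfare n m (gammaMeasure a r) /
        expectedWelfare (rtMean M T (gammaMeasure a r)) (gammaMeasure a r) ≤
          ENNReal.ofReal (3000 * Real.log m) := by
  have ha0 : 0 < a := by linarith
  have := isProbabilityMeasure_gammaMeasure ha0 hr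
  obtain ⟨l, hl, hmed⟩ := exists_median_gammaMeasure ha hr
  have hl0 : 0 < l := lt_of_lt_of_le (by positivity) hl
  refine ⟨Thresholds.single l hl0, fun m hm n hn M hM => ?_⟩
  have hn0 : (0 : ℝ) < n := by exact_mod_cast hn
  have hlog2 : 1 / 2 < Real.log 2 := by linarith [Real.log_two_gt_d9]
  have hlog2' : Real.log 2 < 1 := by linarith [Real.log_two_lt_d9]
  have hlogm : Real.log 2 ≤ Real.log m := Real.log_le_log two_pos (by exact_mod_cast hm)
  have hlow := le_expectedWelfare_rtMean_median (ae_nonneg_gammaMeasure a r) hl0 hmed hm hM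
  have hup := expectedMaxWelfare_gammaMeasure_le (n := n) (m := m) ha0 hr (by omega)
  refine ENNReal.div_le_of_le_mul (hup.trans ?_)
  refine le_trans ?_ (mul_le_mul_right hlow _)
  rw [← ENNReal.ofReal_mul (by positivity)]
  refine ENNReal.ofReal_le_ofReal ?_
  -- Since `1 ≤ 2 * a` and `1 < 2 * log m`, the three terms sum to at most `(4 + 2 + 8) * a * log m
  -- / r`, and `14 < 500 / 30`. The final `3000` is `6 * 500`, the `6` coming from the lower bound
  -- `n * l / 6`.
  have key : 2 / r * (Real.log m + a * Real.log 2 + 1) ≤ 500 * Real.log m * (a / r / 30) := by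
    have h : 2 * (Real.log m + a * Real.log 2 + 1) ≤ 500 * Real.log m * (a / 30) := by
      nlinarith [mul_le_mul_of_nonneg_left hlogm ha0.le,
        mul_le_mul_of_nonneg_right ha (by linarith : 0 ≤ Real.log m)]
    calc 2 / r * (Real.log m + a * Real.log 2 + 1)
        = 2 * (Real.log m + a * Real.log 2 + 1) / r := by ring
      _ ≤ 500 * Real.log m * (a / 30) / r := by gcongr
      _ = _ := by ring
  calc n * (2 / r * (Real.log m + a * Real.log 2 + 1))
      ≤ n * (500 * Real.log m * l) := by
        refine mul_le_mul_of_nonneg_left (key.trans ?_) hn0.le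
        gcongr
    _ = _ := by ring

/-- One choice of thresholds works for all gamma distributions of shape at least `1 / 2`. -/
theorem exists_thresholds : ∃ T : Measure ℝ → Thresholds, ∀ a r : ℝ, 1 / 2 ≤ a → 0 < r →
    ∀ m : ℕ, 2 ≤ m → ∀ n : ℕ, 1 ≤ n → ∀ M : ℝ → Mechanism n m, IsMean M →
      expectedMaxWelfare n m (gammaMeasure a r) /
        expectedWelfare (rtMean M (T (gammaMeasure a r)) (gammaMeasure a r)) (gammaMeasure a r) ≤
          ENNReal.ofReal (3000 * Real.log m) := by
  -- The thresholds must be a function of the measure alone, not of its parameters, so they are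
  -- chosen per `F`, with a dummy value off the gamma family.
  have h : ∀ F : Measure ℝ, ∃ T : Thresholds, ∀ a r : ℝ, 1 / 2 ≤ a → 0 < r →
      F = gammaMeasure a r →
      ∀ m : ℕ, 2 ≤ m → ∀ n : ℕ, 1 ≤ n → ∀ M : ℝ → Mechanism n m, IsMean M →
        expectedMaxWelfare n m F / expectedWelfare (rtMean M T F) F ≤
          ENNReal.ofReal (3000 * Real.log m) := by
    intro F
    by_cases hF : ∃ a r : ℝ, 1 / 2 ≤ a ∧ 0 < r ∧ F = gammaMeasure a r
    · obtain ⟨a, r, ha, hr, rfl⟩ := hF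
      obtain ⟨T, hT⟩ := exists_thresholds_gammaMeasure ha hr
      exact ⟨T, fun _ _ _ _ _ => hT⟩
    · exact ⟨Thresholds.single 1 one_pos, fun a r ha hr h => (hF ⟨a, r, ha, hr, h⟩).elim⟩
  choose T hT using h
  exact ⟨T, fun a r ha hr => hT _ a r ha hr rfl⟩

end Voting

theorem mainTheorem4 :
    -- mean and variance of the three families
    (∀ lam : ℝ, 0 < lam →
      ∫ x, x ∂(ProbabilityTheory.expMeasure lam) = 1 / lam ∧
      ProbabilityTheory.variance id (ProbabilityTheory.expMeasure lam) = 1 / lam ^ 2) ∧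
    (∀ k : ℕ, 0 < k →
      ∫ x, x ∂(Voting.chiSquared k) = k ∧
      ProbabilityTheory.variance id (Voting.chiSquared k) = 2 * k) ∧
    (∀ (k : ℕ) (lam : ℝ), 0 < k → 0 < lam →
      ∫ x, x ∂(Voting.erlang k lam) = 1 / lam ∧
      ProbabilityTheory.variance id (Voting.erlang k lam) = 1 / (k * lam ^ 2)) ∧
    -- the bound on the average distortion, with one absolute constant
    ∃ C : ℝ, 0 < C ∧ ∀ m : ℕ, 2 ≤ m → ∃ T : MeasureTheory.Measure ℝ → Voting.Thresholds,
      ∀ n : ℕ, 1 ≤ n → ∀ M : ℝ → Voting.Mechanism n m, Voting.IsMean M →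
        Voting.avgDistortion (fun F => Voting.rtMean M (T F) F) Voting.exponentialFamily
          ≤ ENNReal.ofReal (C * Real.log m) ∧
        Voting.avgDistortion (fun F => Voting.rtMean M (T F) F) Voting.chiSquaredFamily
          ≤ ENNReal.ofReal (C * Real.log m) ∧
        Voting.avgDistortion (fun F => Voting.rtMean M (T F) F) Voting.erlangFamily
          ≤ ENNReal.ofReal (C * Real.log m) := by
  have hcast : ∀ k : ℕ, 0 < k → (1 : ℝ) ≤ k := fun k hk => by exact_mod_cast hk
  refine ⟨fun lam h => ⟨integral_id_gammaMeasure one_pos h, variance_id_gammaMeasure one_pos h⟩,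
    fun k hk => ?_, fun k lam hk h => ?_, 3000, by norm_num, ?_⟩
  · have hk' : (0 : ℝ) < k / 2 := by linarith [hcast k hk]
    rw [Voting.chiSquared, integral_id_gammaMeasure hk' one_half_pos,
      variance_id_gammaMeasure hk' one_half_pos]
    constructor <;> ring
  · have hk' : (0 : ℝ) < k := by linarith [hcast k hk]
    rw [Voting.erlang, integral_id_gammaMeasure hk' (mul_pos hk' h),
      variance_id_gammaMeasure hk' (mul_pos hk' h)]
    constructor <;> field_simp
  · obtain ⟨T, hT⟩ := Voting.exists_thresholds
    refine fun m hm => ⟨T, fun n hn M hM => ⟨?_, ?_, ?_⟩⟩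
    · refine iSup₂_le ?_
      rintro _ ⟨lam, h, rfl⟩
      -- An exponential distribution is a gamma distribution of shape `1`.
      exact hT 1 lam (by norm_num) h m hm n hn M hM
    · refine iSup₂_le ?_
      rintro _ ⟨k, hk, rfl⟩
      -- The shape is `k / 2`; the case `k = 1` is why shapes down to `1/2` are needed.
      exact hT _ _ (by linarith [hcast k hk]) one_half_pos m hm n hn M hM
    · refine iSup₂_le ?_
      rintro _ ⟨k, lam, hk, h, rfl⟩
      have hk1 := hcast k hk
      exact hT _ _ (by linarith) (mul_pos (by linarith) h) m hm n hn M hM
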